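/- Let $d\ge 2$ and write $\mathbb T^d=\mathbb R^d/\mathbb Z^d$. For $x\in\mathbb T^d$ let $\|x\|=\min_{m\in\mathbb Z^d}|x-m|$, where $|\cdot|$ is the Euclidean norm. For $\gamma\in(0,\tfrac12]$, a sequence $\{v_n\}_{n\ge1}$ in $\mathbb T^d$ is called $\gamma$-uniformly distributed if for every $\epsilon>0$ there is a constant $C_\epsilon$ such that $$\left|\frac1N\sum_{n=1}^N e^{2\pi i k\cdot v_n}\right|\le C_\epsilon|k|^{\epsilon}N^{-\gamma}\qquad\text{for all } k\in\mathbb Z^d\setminus\{0\}\text{ and all } N\ge1.$$ For $\tfrac1{100}\le a\le b<\tfrac12$ let $\Omega_{a,b}=\{(x,y)\in\mathbb T^d\times\mathbb T^d: a\le\|x-y\|\le b\}$ and let $|\Omega_{a,b}|$ be its Lebesgue measure. Theorem. Let $d\ge2$. There are constants $c_1,c_2>0$, depending only on $d$, such that $c_1(b-a)\le|\Omega_{a,b}|\le c_2(b-a)$ whenever $\tfrac1{100}\le a\le b<\tfrac12$, and such that the following holds for every $\gamma\in(0,\tfrac12]$ and every $\gamma$-uniformly distributed sequence $\{v_n\}$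 in $\mathbb T^d$. (i) For every $\epsilon>0$ there is a constant $C_\epsilon$ (depending on the sequence and on $\epsilon$, but not on $a$, $b$, $N$) such that for all $\tfrac1{100}\le a\le b<\tfrac12$ and all $N\ge1$, $$\#\{(n,m)\in\{1,\dots,N\}^2: a\le\|v_n-v_m\|\le b\}=N^2|\Omega_{a,b}|+R(a,b,N),\qquad |R(a,b,N)|\le C_\epsilon N^{2-\frac{4\gamma}{d+1}+\epsilon}.$$ (ii) For all $c>0$ and $\epsilon>0$ there is $N_0$ such that for all $N\ge N_0$ and all $\tfrac1{100}\le a\le b<\tfrac12$ with $b-a\ge cN^{-\frac{4\gamma}{d+1}+\epsilon}$, $$c_1N^2(b-a)\le\#\{(n,m)\in\{1,\dots,N\}^2: a\le\|v_n-v_m\|\le b\}\le c_2N^2(b-a).$$ -/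

import Mathlib

noncomputable section

/-- The distance from a point `x` of the torus `ℝᵈ / ℤᵈ` to the origin in the flat metric: the least
Euclidean norm among the representatives of `x` in `ℝᵈ`.  (Mathlib's own norm on `UnitAddTorus` is
a sup norm.) -/
def torusNorm {d : ℕ} (x : UnitAddTorus (Fin d)) : ℝ :=
  sInf {r : ℝ | ∃ y : EuclideanSpace ℝ (Fin d),
    (∀ i, ((y i : ℝ) : UnitAddCircle) = x i) ∧ ‖y‖ = r}

/-- The infimum in the definition of `torusNorm` is a minimum, attained when every coordinate of the
representative is reduced to `[-1/2, 1/2]`. -/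
theorem torusNorm_isLeast {d : ℕ} (x : UnitAddTorus (Fin d)) :
    IsLeast {r : ℝ | ∃ y : EuclideanSpace ℝ (Fin d),
      (∀ i, ((y i : ℝ) : UnitAddCircle) = x i) ∧ ‖y‖ = r} (√(∑ i, ‖x i‖ ^ 2)) := by
  constructor
  · choose t ht using fun i => QuotientAddGroup.mk_surjective (x i)
    refine ⟨WithLp.toLp 2 fun i => t i - round (t i), fun i => ?_, ?_⟩
    · rw [← ht i]
      have h : ((round (t i) : ℝ) : UnitAddCircle) = 0 :=
        (AddCircle.coe_eq_zero_iff 1).2 ⟨round (t i), by simp⟩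
      change ((t i - round (t i) : ℝ) : UnitAddCircle) = (t i : UnitAddCircle)
      rw [AddCircle.coe_sub, h, sub_zero]
    · rw [EuclideanSpace.norm_eq]
      congr 1
      refine Finset.sum_congr rfl fun i _ => ?_
      rw [← ht i]
      exact congrArg (· ^ 2) (UnitAddCircle.norm_eq (x := t i)).symm
  · rintro r ⟨y, hy, rfl⟩
    rw [EuclideanSpace.norm_eq]
    refine Real.sqrt_le_sqrt (Finset.sum_le_sum fun i _ => ?_)
    rw [← hy i]
    gcongr
    rw [UnitAddCircle.norm_eq, Real.norm_eq_abs]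
    simpa using round_le (y i) 0

theorem torusNorm_eq {d : ℕ} (x : UnitAddTorus (Fin d)) :
    torusNorm x = √(∑ i, ‖x i‖ ^ 2) :=
  (torusNorm_isLeast x).csInf_eq

/-- The sequence `v 1, v 2, …` of points of the torus is `γ`-uniformly distributed: for every
`ε > 0` there is a constant `C` such that, for all `N ≥ 1` and all nonzero frequencies `k ∈ ℤᵈ`,
`|N⁻¹ ∑_{n = 1}^N e^{2πi k·v_n}| ≤ C |k|^ε N^{-γ}`, where `|k|` is the Euclidean norm.  Here
`UnitAddTorus.mFourier k` is the character `x ↦ e^{2πi k·x}`. -/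
def IsGammaUniformlyDistributed {d : ℕ} (γ : ℝ) (v : ℕ → UnitAddTorus (Fin d)) : Prop :=
  ∀ ε : ℝ, 0 < ε → ∃ C : ℝ, ∀ k : Fin d → ℤ, k ≠ 0 → ∀ N : ℕ, 1 ≤ N →
    ‖(1 / (N : ℂ)) * ∑ n ∈ Finset.Icc 1 N, UnitAddTorus.mFourier k (v n)‖ ≤
      C * ‖(WithLp.toLp 2 fun i => (k i : ℝ) : EuclideanSpace ℝ (Fin d))‖ ^ ε * (N : ℝ) ^ (-γ)

/-- `Ω_{a,b}`, the set of pairs of points of the torus whose distance is between `a` and `b`. -/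
def annulusRel (d : ℕ) (a b : ℝ) : Set (UnitAddTorus (Fin d) × UnitAddTorus (Fin d)) :=
  {p | a ≤ torusNorm (p.1 - p.2) ∧ torusNorm (p.1 - p.2) ≤ b}

/-- The number of pairs of indices `(n, m) ∈ [1, N]²` with `a ≤ ‖v_n - v_m‖ ≤ b`, that is, the number
of incidences between the first `N` points and the `N` annuli centered at them. -/
def annulusCount {d : ℕ} (v : ℕ → UnitAddTorus (Fin d)) (a b : ℝ) (N : ℕ) : ℕ :=
  {p : ℕ × ℕ | p.1 ∈ Set.Icc 1 N ∧ p.2 ∈ Set.Icc 1 N ∧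
    a ≤ torusNorm (v p.1 - v p.2) ∧ torusNorm (v p.1 - v p.2) ≤ b}.ncard

end

/-!
Write `1_A` for the indicator function of the shell `A = {x : a ≤ ‖x‖ ≤ b}`. The number of pairs is
`∑_{n, m ≤ N} 1_A(v_n - v_m)`, and for a function `f` with absolutely convergent Fourier series
`∑_{n, m ≤ N} f(v_n - v_m) = ∑_k f̂(k) |∑_{n ≤ N} e(k · v_n)|²`. The frequency `k = 0` contributes
`N² ∫ f`; the hypothesis on the sequence bounds the rest by `N^{2 - 2γ} ∑_k |f̂(k)| |k|^{2ε}` up to a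
constant.

The indicator function is replaced by its average over translations of length at most `δ`
(`smoothShell`), which for the shells of radii `a - δ, b + δ` and `a + δ, b - δ` lies above and
below `1_A`; this changes the main term by `O(δ N²)`. The Fourier coefficients of the average are
those of the indicator function times a rapidly decreasing function of `δ k`.

No pointwise decay of the Fourier transform of a ball is needed, only its decay in square mean: since
the boundary of a shell has finite area, `‖1_A(· + h) - 1_A‖₂² = O(|h|)`, so `1_A` is bounded in
every Sobolev space of order less than `1/2`, uniformly in the radii (`exists_tsum_sobolev_le`). By the
arithmetic–geometric mean inequality this gives `∑_k |f̂(k)| |k|^{2ε} = O(δ^{-(d-1)/2 - 4ε})`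
(`exists_tsum_norm_mFourierCoeff_smoothShell_le`). The two errors `N² δ` and
`N^{2 - 2γ} δ^{-(d-1)/2}` balance at `δ = N^{-4γ/(d+1)}`, which is the asymptotic formula
(`exists_abs_annulusCount_sub_le_rpow`). The two-sided bound on the count follows from it, because
the volume of a shell is comparable to its width.
-/

open MeasureTheory Set Filter Topology
open scoped ENNReal

/-! ### Shells in the torus and their volumes -/

/-- The covering map `ℝᵈ → ℝᵈ / ℤᵈ`. -/
def torusProj {d : ℕ} (y : EuclideanSpace ℝ (Fin d)) : UnitAddTorus (Fin d) :=
  fun i => ((y i : ℝ) : UnitAddCircle)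

theorem torusProj_add {d : ℕ} (y z : EuclideanSpace ℝ (Fin d)) :
    torusProj (y + z) = torusProj y + torusProj z := by
  ext i; simp [torusProj]

theorem torusProj_neg {d : ℕ} (y : EuclideanSpace ℝ (Fin d)) :
    torusProj (-y) = -torusProj y := by
  ext i; simp [torusProj]

theorem torusProj_sub {d : ℕ} (y z : EuclideanSpace ℝ (Fin d)) :
    torusProj (y - z) = torusProj y - torusProj z := by
  rw [sub_eq_add_neg, torusProj_add, torusProj_neg, sub_eq_add_neg]

theorem continuous_torusProj {d : ℕ} : Continuous (torusProj (d := d)) :=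
  continuous_pi fun i => (AddCircle.continuous_mk' 1).comp (by fun_prop)

theorem isOpenQuotientMap_torusProj {d : ℕ} : IsOpenQuotientMap (torusProj (d := d)) := by
  have h : IsOpenQuotientMap (Pi.map fun (_ : Fin d) (t : ℝ) => (t : UnitAddCircle)) :=
    IsOpenQuotientMap.piMap fun _ => QuotientAddGroup.isOpenQuotientMap_mk
  exact h.comp (EuclideanSpace.equiv (Fin d) ℝ).toHomeomorph.isOpenQuotientMap

theorem torusNorm_torusProj_le {d : ℕ} (y : EuclideanSpace ℝ (Fin d)) :
    torusNorm (torusProj y) ≤ ‖y‖ := by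
  rw [torusNorm_eq]
  exact (torusNorm_isLeast _).2 ⟨y, fun _ => rfl, rfl⟩

theorem exists_torusProj_eq_norm_eq {d : ℕ} (x : UnitAddTorus (Fin d)) :
    ∃ y, torusProj y = x ∧ ‖y‖ = torusNorm x := by
  obtain ⟨y, hy, h⟩ := (torusNorm_isLeast x).1
  exact ⟨y, funext hy, by rw [h, torusNorm_eq]⟩

theorem torusNorm_add_le {d : ℕ} (x y : UnitAddTorus (Fin d)) :
    torusNorm (x + y) ≤ torusNorm x + torusNorm y := by
  obtain ⟨u, rfl, hu⟩ := exists_torusProj_eq_norm_eq x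
  obtain ⟨w, rfl, hw⟩ := exists_torusProj_eq_norm_eq y
  rw [← torusProj_add, ← hu, ← hw]
  exact (torusNorm_torusProj_le _).trans (norm_add_le _ _)

theorem torusNorm_neg {d : ℕ} (x : UnitAddTorus (Fin d)) : torusNorm (-x) = torusNorm x := by
  simp [torusNorm_eq]

theorem torusNorm_nonneg {d : ℕ} (x : UnitAddTorus (Fin d)) : 0 ≤ torusNorm x := by
  rw [torusNorm_eq]; positivity

theorem torusNorm_sub_torusProj_mem {d : ℕ} (x : UnitAddTorus (Fin d))
    (y : EuclideanSpace ℝ (Fin d)) :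
    torusNorm x - ‖y‖ ≤ torusNorm (x - torusProj y) ∧
      torusNorm (x - torusProj y) ≤ torusNorm x + ‖y‖ := by
  have h1 := torusNorm_add_le (x - torusProj y) (torusProj y)
  have h2 := torusNorm_add_le x (-torusProj y)
  have h3 := torusNorm_torusProj_le y
  rw [sub_add_cancel] at h1
  rw [torusNorm_neg, ← sub_eq_add_neg] at h2
  constructor <;> linarith

theorem continuous_torusNorm {d : ℕ} : Continuous (torusNorm (d := d)) := by
  have : torusNorm (d := d) = fun x => √(∑ i, ‖x i‖ ^ 2) := funext torusNorm_eq
  rw [this]; fun_prop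

theorem torusNorm_le_dim {d : ℕ} (x : UnitAddTorus (Fin d)) : torusNorm x ≤ d := by
  rw [torusNorm_eq]
  refine Real.sqrt_le_iff.2 ⟨by positivity, ?_⟩
  have h : ∀ i : Fin d, ‖x i‖ ^ 2 ≤ 1 := fun i => by
    have := AddCircle.norm_le_half_period 1 (x := x i) one_ne_zero
    have h0 := norm_nonneg (x i)
    norm_num at this
    nlinarith
  calc ∑ i, ‖x i‖ ^ 2 ≤ ∑ i : Fin d, (1 : ℝ) := Finset.sum_le_sum fun i _ => h i
    _ = d := by simp
    _ ≤ (d : ℝ) ^ 2 := by exact_mod_cast Nat.le_self_pow two_ne_zero d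

theorem torusNorm_torusProj_of_mem {d : ℕ} {y : EuclideanSpace ℝ (Fin d)}
    (hy : ∀ i, |y i| ≤ 1 / 2) : torusNorm (torusProj y) = ‖y‖ := by
  rw [torusNorm_eq, EuclideanSpace.norm_eq]
  congr 1
  refine Finset.sum_congr rfl fun i _ => ?_
  have : ‖torusProj y i‖ = |y i| :=
    (AddCircle.norm_coe_eq_abs_iff 1 one_ne_zero).2 (by simpa using hy i)
  rw [this, Real.norm_eq_abs]

/-- The points of the torus whose distance to the origin lies in `[s, t]`. -/
def torusShell (d : ℕ) (s t : ℝ) : Set (UnitAddTorus (Fin d)) :=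
  {x | s ≤ torusNorm x ∧ torusNorm x ≤ t}

theorem measurableSet_torusShell (d : ℕ) (s t : ℝ) : MeasurableSet (torusShell d s t) :=
  ((isClosed_le continuous_const continuous_torusNorm).inter
    (isClosed_le continuous_torusNorm continuous_const)).measurableSet

instance isProbabilityMeasure_unitAddCircle :
    IsProbabilityMeasure (volume : Measure UnitAddCircle) := ⟨UnitAddCircle.measure_univ⟩

/-- The covering map preserves Lebesgue measure when restricted to a fundamental cube. -/
theorem measurePreserving_torusProj (d : ℕ) :
    MeasurePreserving (torusProj (d := d))
      (volume.restrict {y | ∀ i, y i ∈ Ioc (-(1 / 2) : ℝ) (1 / 2)}) volume := by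
  have h1 : MeasurePreserving (fun (t : Fin d → ℝ) i => (t i : UnitAddCircle))
      (volume.restrict (Set.pi univ fun _ => Ioc (-(1 / 2) : ℝ) (1 / 2))) volume := by
    have := measurePreserving_pi (fun _ : Fin d => volume.restrict (Ioc (-(1 / 2) : ℝ) (1 / 2)))
      (fun _ : Fin d => (volume : Measure UnitAddCircle))
      (f := fun _ (t : ℝ) => (t : UnitAddCircle)) (fun _ => by
        have := UnitAddCircle.measurePreserving_mk (-(1 / 2))
        norm_num at this ⊢
        exact this)
    rwa [← Measure.restrict_pi_pi] at this
  have h2 := (PiLp.volume_preserving_ofLp (Fin d)).restrict_preimage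
    (s := Set.pi univ fun _ => Ioc (-(1 / 2) : ℝ) (1 / 2))
    (MeasurableSet.univ_pi fun _ => measurableSet_Ioc)
  have h3 := h1.comp h2
  have hS : {y : EuclideanSpace ℝ (Fin d) | ∀ i, y i ∈ Ioc (-(1 / 2) : ℝ) (1 / 2)} =
      WithLp.ofLp ⁻¹' Set.pi univ fun _ => Ioc (-(1 / 2) : ℝ) (1 / 2) := by
    ext y; simp
  rw [hS]
  exact h3

theorem volume_euclidean_shell (d : ℕ) (hd : d ≠ 0) {s t : ℝ} (hs : 0 ≤ s) (hst : s ≤ t) :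
    volume.real {y : EuclideanSpace ℝ (Fin d) | s ≤ ‖y‖ ∧ ‖y‖ ≤ t} =
      (t ^ d - s ^ d) * volume.real (Metric.ball (0 : EuclideanSpace ℝ (Fin d)) 1) := by
  have : NeZero d := ⟨hd⟩
  have h : {y : EuclideanSpace ℝ (Fin d) | s ≤ ‖y‖ ∧ ‖y‖ ≤ t} =
      Metric.closedBall 0 t \ Metric.ball 0 s := by
    ext y; simp [and_comm]
  have hb : volume.real (Metric.closedBall (0 : EuclideanSpace ℝ (Fin d)) t) =
      t ^ d * volume.real (Metric.ball (0 : EuclideanSpace ℝ (Fin d)) 1) := by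
    rw [measureReal_def, Measure.addHaar_closedBall _ _ (hs.trans hst), ENNReal.toReal_mul,
      ENNReal.toReal_ofReal (by have := hs.trans hst; positivity), finrank_euclideanSpace_fin]
    rfl
  have hb' : volume.real (Metric.ball (0 : EuclideanSpace ℝ (Fin d)) s) =
      s ^ d * volume.real (Metric.ball (0 : EuclideanSpace ℝ (Fin d)) 1) := by
    rw [measureReal_def, Measure.addHaar_ball _ _ hs, ENNReal.toReal_mul,
      ENNReal.toReal_ofReal (by positivity), finrank_euclideanSpace_fin]
    rfl
  rw [h, measureReal_sdiff ((Metric.ball_subset_ball hst).trans Metric.ball_subset_closedBall)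
    Metric.isOpen_ball.measurableSet measure_closedBall_lt_top.ne, hb, hb']
  ring

theorem volume_torusShell (d : ℕ) (s t : ℝ) :
    volume.real (torusShell d s t) = volume.real {y : EuclideanSpace ℝ (Fin d) |
      (s ≤ ‖y‖ ∧ ‖y‖ ≤ t) ∧ ∀ i, y i ∈ Ioc (-(1 / 2) : ℝ) (1 / 2)} := by
  have h := (measurePreserving_torusProj d).measureReal_preimage
    (measurableSet_torusShell d s t).nullMeasurableSet
  rw [← h, measureReal_restrict_apply
    (continuous_torusProj.measurable (measurableSet_torusShell d s t))]
  congr 1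
  ext y
  simp only [mem_inter_iff, mem_preimage, torusShell, mem_ofPred_eq]
  refine and_congr_left fun hy => ?_
  rw [torusNorm_torusProj_of_mem fun i => abs_le.2 ⟨(hy i).1.le, (hy i).2⟩]

/-- Below radius `1 / 2` a Euclidean shell lies in the fundamental cube. -/
theorem volume_torusShell_eq (d : ℕ) (hd : d ≠ 0) {s t : ℝ} (hs : 0 ≤ s) (hst : s ≤ t)
    (ht : t < 1 / 2) : volume.real (torusShell d s t) =
      (t ^ d - s ^ d) * volume.real (Metric.ball (0 : EuclideanSpace ℝ (Fin d)) 1) := by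
  rw [volume_torusShell, ← volume_euclidean_shell d hd hs hst]
  congr 1
  ext y
  refine ⟨fun h => h.1, fun h => ⟨h, fun i => ?_⟩⟩
  have h1 : |y i| ≤ ‖y‖ := by simpa using PiLp.norm_apply_le y i
  have h2 := abs_lt.1 ((h1.trans h.2).trans_lt ht)
  exact ⟨h2.1, h2.2.le⟩

/-- For large radii the Euclidean shell may leave the fundamental cube, and only the upper bound
remains. -/
theorem volume_torusShell_le (d : ℕ) (hd : d ≠ 0) {s t : ℝ} (hs : 0 ≤ s) (hst : s ≤ t) :
    volume.real (torusShell d s t) ≤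
      (t ^ d - s ^ d) * volume.real (Metric.ball (0 : EuclideanSpace ℝ (Fin d)) 1) := by
  rw [volume_torusShell, ← volume_euclidean_shell d hd hs hst]
  refine measureReal_mono (fun y h => h.1) (ne_of_lt ?_)
  exact (measure_mono (fun y hy => by simpa using hy.2)).trans_lt
    (measure_closedBall_lt_top (x := (0 : EuclideanSpace ℝ (Fin d))) (r := t))

theorem pow_sub_pow_le {d : ℕ} {s t R : ℝ} (hs : 0 ≤ s) (hst : s ≤ t) (ht : t ≤ R) :
    t ^ d - s ^ d ≤ d * R ^ (d - 1) * (t - s) := by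
  rw [← Commute.geom_sum₂_mul (Commute.all t s)]
  gcongr
  have hR : 0 ≤ R := by linarith
  calc ∑ i ∈ Finset.range d, t ^ i * s ^ (d - 1 - i)
      ≤ ∑ i ∈ Finset.range d, R ^ (d - 1) := Finset.sum_le_sum fun i hi => by
        have hi := Finset.mem_range.1 hi
        calc t ^ i * s ^ (d - 1 - i) ≤ R ^ i * R ^ (d - 1 - i) := by
              have := hs.trans hst
              have := hst.trans ht
              gcongr
          _ = R ^ (d - 1) := by rw [← pow_add]; congr 1; omega
    _ = d * R ^ (d - 1) := by simp

theorem le_pow_sub_pow {d : ℕ} {s t r : ℝ} (hr : 0 ≤ r) (hs : r ≤ s) (hst : s ≤ t) :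
    d * r ^ (d - 1) * (t - s) ≤ t ^ d - s ^ d := by
  rw [← Commute.geom_sum₂_mul (Commute.all t s)]
  gcongr
  calc d * r ^ (d - 1) = ∑ i ∈ Finset.range d, r ^ (d - 1) := by simp
    _ ≤ ∑ i ∈ Finset.range d, t ^ i * s ^ (d - 1 - i) := Finset.sum_le_sum fun i hi => by
        have hi := Finset.mem_range.1 hi
        calc r ^ (d - 1) = r ^ i * r ^ (d - 1 - i) := by rw [← pow_add]; congr 1; omega
          _ ≤ t ^ i * s ^ (d - 1 - i) := by
              have h0 := hr.trans hs
              have ht := hs.trans hst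
              have h0t := h0.trans hst
              gcongr

/-- Shells have volume at most proportional to their width, with no restriction on the radii: the
torus is bounded, so the radii may be clamped to a bounded interval. -/
theorem exists_volume_torusShell_le (d : ℕ) (hd : d ≠ 0) :
    ∃ C : ℝ, 0 < C ∧ ∀ s t : ℝ, s ≤ t → volume.real (torusShell d s t) ≤ C * (t - s) := by
  set ω := volume.real (Metric.ball (0 : EuclideanSpace ℝ (Fin d)) 1)
  have hω : 0 < ω :=
    ENNReal.toReal_pos (Metric.measure_ball_pos _ _ one_pos).ne' measure_ball_lt_top.ne
  have hd' : (0 : ℝ) < d := by positivity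
  refine ⟨d * (d : ℝ) ^ (d - 1) * ω, by positivity, fun s t hst => ?_⟩
  have hsub : torusShell d s t ⊆ torusShell d (max s 0) (min t d) := fun x hx =>
    ⟨max_le hx.1 (torusNorm_nonneg x), le_min hx.2 (torusNorm_le_dim x)⟩
  refine (measureReal_mono hsub).trans ?_
  by_cases h : max s 0 ≤ min t d
  · refine (volume_torusShell_le d hd (le_max_right _ _) h).trans ?_
    have h1 := pow_sub_pow_le (d := d) (le_max_right s 0) h (min_le_right _ _)
    have h2 : min t d - max s 0 ≤ t - s := sub_le_sub (min_le_left _ _) (le_max_left _ _)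
    calc _ ≤ (d * (d : ℝ) ^ (d - 1) * (min t d - max s 0)) * ω := by gcongr
      _ ≤ (d * (d : ℝ) ^ (d - 1) * (t - s)) * ω := by gcongr
      _ = _ := by ring
  · have : torusShell d (max s 0) (min t d) = ∅ := by
      ext x; simp only [torusShell, mem_ofPred_eq, mem_empty_iff_false, iff_false]
      exact fun hx => h (hx.1.trans hx.2)
    rw [this, measureReal_empty]
    have : 0 ≤ t - s := by linarith
    positivity

theorem exists_le_volume_torusShell (d : ℕ) (hd : d ≠ 0) :
    ∃ c : ℝ, 0 < c ∧ ∀ s t : ℝ, 1 / 100 ≤ s → s ≤ t → t < 1 / 2 →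
      c * (t - s) ≤ volume.real (torusShell d s t) := by
  set ω := volume.real (Metric.ball (0 : EuclideanSpace ℝ (Fin d)) 1)
  have hω : 0 < ω :=
    ENNReal.toReal_pos (Metric.measure_ball_pos _ _ one_pos).ne' measure_ball_lt_top.ne
  refine ⟨d * (1 / 100 : ℝ) ^ (d - 1) * ω, by positivity, fun s t hs hst ht => ?_⟩
  rw [volume_torusShell_eq d hd (by linarith) hst ht]
  calc d * (1 / 100 : ℝ) ^ (d - 1) * ω * (t - s) = d * (1 / 100 : ℝ) ^ (d - 1) * (t - s) * ω := by
        ring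
    _ ≤ (t ^ d - s ^ d) * ω := by
        gcongr
        exact le_pow_sub_pow (by norm_num) hs hst

theorem volume_annulusRel (d : ℕ) (a b : ℝ) :
    volume.real (annulusRel d a b) = volume.real (torusShell d a b) := by
  have h : MeasurePreserving
      (fun p : UnitAddTorus (Fin d) × UnitAddTorus (Fin d) => (p.1 - p.2, p.2))
      (volume.prod volume) (volume.prod volume) := measurePreserving_sub_prod volume volume
  have h' := (measurePreserving_fst (μ := (volume : Measure (UnitAddTorus (Fin d))))
    (ν := (volume : Measure (UnitAddTorus (Fin d))))).comp h
  exact h'.measureReal_preimage (measurableSet_torusShell d a b).nullMeasurableSet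

/-! ### Fourier coefficients on the torus -/

theorem volume_unitAddCircle_eq_haarAddCircle :
    (volume : Measure UnitAddCircle) = AddCircle.haarAddCircle := by
  rw [AddCircle.volume_eq_smul_haarAddCircle, ENNReal.ofReal_one, one_smul]

/-- Mathlib defines `mFourierCoeff` with the Haar probability measure of each circle. -/
theorem volume_unitAddTorus_eq_pi_haarAddCircle (d : ℕ) :
    (volume : Measure (UnitAddTorus (Fin d))) = Measure.pi fun _ => AddCircle.haarAddCircle := by
  rw [volume_pi, volume_unitAddCircle_eq_haarAddCircle]

theorem mFourierCoeff_eq_integral_volume {d : ℕ} (f : UnitAddTorus (Fin d) → ℂ)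
    (k : Fin d → ℤ) :
    UnitAddTorus.mFourierCoeff f k = ∫ x, UnitAddTorus.mFourier (-k) x * f x := by
  rw [volume_unitAddTorus_eq_pi_haarAddCircle]
  rfl

theorem hasSum_sq_mFourierCoeff_of_bounded {d : ℕ} {f : UnitAddTorus (Fin d) → ℂ}
    (hf : Measurable f) {M : ℝ} (hM : ∀ x, ‖f x‖ ≤ M) :
    HasSum (fun k => ‖UnitAddTorus.mFourierCoeff f k‖ ^ 2) (∫ x, ‖f x‖ ^ 2) := by
  have h2 : MemLp f 2 (Measure.pi fun _ => AddCircle.haarAddCircle) :=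
    MemLp.of_bound hf.aestronglyMeasurable M (Eventually.of_forall hM)
  have h := UnitAddTorus.hasSum_sq_mFourierCoeff (h2.toLp f)
  have hae := h2.coeFn_toLp
  have h3 : (∫ x, ‖f x‖ ^ 2) =
      ∫ x, ‖h2.toLp f x‖ ^ 2 ∂(Measure.pi fun _ => AddCircle.haarAddCircle) := by
    rw [volume_unitAddTorus_eq_pi_haarAddCircle]
    refine integral_congr_ae ?_
    filter_upwards [hae] with x hx
    rw [hx]
  have h4 : ∀ k, UnitAddTorus.mFourierCoeff (h2.toLp f) k = UnitAddTorus.mFourierCoeff f k := by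
    intro k
    refine integral_congr_ae ?_
    filter_upwards [hae] with x hx
    rw [hx]
  rw [h3]
  simp only [h4] at h
  exact h

theorem mFourier_apply_add {d : ℕ} (k : Fin d → ℤ) (x y : UnitAddTorus (Fin d)) :
    UnitAddTorus.mFourier k (x + y) = UnitAddTorus.mFourier k x * UnitAddTorus.mFourier k y := by
  simp [UnitAddTorus.mFourier, fourier_apply, AddCircle.toCircle_add, Finset.prod_mul_distrib]

theorem norm_mFourier_apply {d : ℕ} (k : Fin d → ℤ) (x : UnitAddTorus (Fin d)) :
    ‖UnitAddTorus.mFourier k x‖ = 1 := by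
  simp only [UnitAddTorus.mFourier, fourier_apply, ContinuousMap.coe_mk, norm_prod,
    Circle.norm_coe, Finset.prod_const_one]

theorem mFourier_apply_neg {d : ℕ} (k : Fin d → ℤ) (x : UnitAddTorus (Fin d)) :
    UnitAddTorus.mFourier k (-x) = UnitAddTorus.mFourier (-k) x := by
  simp [UnitAddTorus.mFourier, fourier_apply]

theorem mFourier_torusProj {d : ℕ} (k : Fin d → ℤ) (y : EuclideanSpace ℝ (Fin d)) :
    UnitAddTorus.mFourier k (torusProj y) =
      Complex.exp ((2 * Real.pi * ∑ i, k i * y i : ℝ) * Complex.I) := by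
  have h : ∀ i, (fourier (k i) (torusProj y i) : ℂ) =
      Complex.exp ((2 * Real.pi * (k i * y i) : ℝ) * Complex.I) := fun i => by
    rw [torusProj, fourier_coe_apply]
    congr 1
    push_cast
    ring
  change ∏ i, (fourier (k i) (torusProj y i) : ℂ) = _
  rw [Finset.prod_congr rfl fun i _ => h i, ← Complex.exp_sum, ← Finset.sum_mul]
  congr 2
  push_cast
  rw [Finset.mul_sum]

theorem mFourierCoeff_comp_sub {d : ℕ} (f : UnitAddTorus (Fin d) → ℂ) (y : UnitAddTorus (Fin d))
    (k : Fin d → ℤ) :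
    UnitAddTorus.mFourierCoeff (fun x => f (x - y)) k =
      UnitAddTorus.mFourier (-k) y * UnitAddTorus.mFourierCoeff f k := by
  rw [mFourierCoeff_eq_integral_volume, mFourierCoeff_eq_integral_volume, ← integral_const_mul,
    ← integral_sub_right_eq_self
      (fun x => UnitAddTorus.mFourier (-k) y * (UnitAddTorus.mFourier (-k) x * f x)) y]
  congr 1 with x
  rw [← mul_assoc, ← mFourier_apply_add, add_sub_cancel]

/-- The indicator function of a shell, with complex values. -/
noncomputable def shellIndicator (d : ℕ) (s t : ℝ) : UnitAddTorus (Fin d) → ℂ :=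
  (torusShell d s t).indicator 1

theorem measurable_shellIndicator (d : ℕ) (s t : ℝ) : Measurable (shellIndicator d s t) :=
  measurable_one.indicator (measurableSet_torusShell d s t)

theorem norm_shellIndicator_le (d : ℕ) (s t : ℝ) (x : UnitAddTorus (Fin d)) :
    ‖shellIndicator d s t x‖ ≤ 1 := by
  by_cases h : x ∈ torusShell d s t <;> simp [shellIndicator, h]

/-- A translation by `y` moves points in or out of a shell only within `‖y‖` of a bounding sphere. -/
theorem norm_shellIndicator_sub_le (d : ℕ) (s t : ℝ) (x : UnitAddTorus (Fin d))
    (y : EuclideanSpace ℝ (Fin d)) :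
    ‖shellIndicator d s t (x - torusProj y) - shellIndicator d s t x‖ ^ 2 ≤
      (torusShell d (s - ‖y‖) (s + ‖y‖) ∪ torusShell d (t - ‖y‖) (t + ‖y‖)).indicator 1 x := by
  by_cases h : x ∈ torusShell d (s - ‖y‖) (s + ‖y‖) ∪ torusShell d (t - ‖y‖) (t + ‖y‖)
  · rw [indicator_of_mem h]
    by_cases h1 : x ∈ torusShell d s t <;> by_cases h2 : x - torusProj y ∈ torusShell d s t <;>
      simp [shellIndicator, h1, h2]
  · rw [indicator_of_notMem h]
    have h3 : x - torusProj y ∈ torusShell d s t ↔ x ∈ torusShell d s t := by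
      have := torusNorm_sub_torusProj_mem x y
      simp only [torusShell, mem_union, mem_ofPred_eq, not_or, not_and_or, not_le] at h ⊢
      grind
    by_cases h1 : x ∈ torusShell d s t <;> simp [shellIndicator, h1, h3]

/-- The `L²` modulus of continuity of the indicator function of a shell, on the Fourier side. -/
theorem exists_tsum_mFourier_sub_one_le (d : ℕ) (hd : d ≠ 0) :
    ∃ C : ℝ, 0 < C ∧ ∀ s t : ℝ, ∀ y : EuclideanSpace ℝ (Fin d),
      ∑' k, ENNReal.ofReal (‖UnitAddTorus.mFourier (-k) (torusProj y) - 1‖ ^ 2 *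
        ‖UnitAddTorus.mFourierCoeff (shellIndicator d s t) k‖ ^ 2) ≤ ENNReal.ofReal (C * ‖y‖) := by
  obtain ⟨C, hC, hvol⟩ := exists_volume_torusShell_le d hd
  refine ⟨4 * C, by positivity, fun s t y => ?_⟩
  set F := shellIndicator d s t
  have hm : Measurable fun x => F (x - torusProj y) :=
    (measurable_shellIndicator d s t).comp (measurable_id.sub_const _)
  have hint : ∀ g : UnitAddTorus (Fin d) → ℂ, Measurable g → (∀ x, ‖g x‖ ≤ 1) → ∀ k,
      Integrable (fun x => UnitAddTorus.mFourier (-k) x * g x) := fun g hg hg1 k =>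
    Integrable.of_bound (C := 1) (((UnitAddTorus.mFourier (-k)).continuous.measurable.mul
      hg).aestronglyMeasurable) (Eventually.of_forall fun x => by
        rw [norm_mul, norm_mFourier_apply, one_mul]; exact hg1 x)
  have hcoef : ∀ k, UnitAddTorus.mFourierCoeff (fun x => F (x - torusProj y) - F x) k =
      (UnitAddTorus.mFourier (-k) (torusProj y) - 1) * UnitAddTorus.mFourierCoeff F k := by
    intro k
    have h := mFourierCoeff_comp_sub F (torusProj y) k
    rw [sub_mul, ← h, one_mul]
    simp only [mFourierCoeff_eq_integral_volume, mul_sub]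
    exact integral_sub (hint _ hm (fun x => norm_shellIndicator_le _ _ _ _) k)
      (hint _ (measurable_shellIndicator d s t) (norm_shellIndicator_le d s t) k)
  have hP := hasSum_sq_mFourierCoeff_of_bounded (f := fun x => F (x - torusProj y) - F x)
    (hm.sub (measurable_shellIndicator d s t)) (M := 2)
    (fun x => (norm_sub_le _ _).trans (by
      have h1 := norm_shellIndicator_le d s t (x - torusProj y)
      have h2 := norm_shellIndicator_le d s t x
      linarith))
  simp only [hcoef, norm_mul, mul_pow] at hP
  rw [← ENNReal.ofReal_tsum_of_nonneg (fun k => by positivity) hP.summable, hP.tsum_eq]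
  refine ENNReal.ofReal_le_ofReal ?_
  set U := torusShell d (s - ‖y‖) (s + ‖y‖) ∪ torusShell d (t - ‖y‖) (t + ‖y‖)
  have hU : MeasurableSet U :=
    (measurableSet_torusShell _ _ _).union (measurableSet_torusShell _ _ _)
  calc ∫ x, ‖F (x - torusProj y) - F x‖ ^ 2 ≤ ∫ x, U.indicator 1 x := by
        refine integral_mono_of_nonneg (Eventually.of_forall fun x => by positivity)
          ((integrable_const 1).indicator hU)
          (Eventually.of_forall fun x => norm_shellIndicator_sub_le d s t x y)
    _ = volume.real U := integral_indicator_one hU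
    _ ≤ volume.real (torusShell d (s - ‖y‖) (s + ‖y‖)) +
        volume.real (torusShell d (t - ‖y‖) (t + ‖y‖)) := measureReal_union_le _ _
    _ ≤ C * ((s + ‖y‖) - (s - ‖y‖)) + C * ((t + ‖y‖) - (t - ‖y‖)) :=
        add_le_add (hvol _ _ (by linarith [norm_nonneg y])) (hvol _ _ (by linarith [norm_nonneg y]))
    _ = 4 * C * ‖y‖ := by ring

/-- A frequency `k ∈ ℤᵈ` as a vector of `ℝᵈ`. -/
noncomputable def latticeVec {d : ℕ} (k : Fin d → ℤ) : EuclideanSpace ℝ (Fin d) :=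
  WithLp.toLp 2 fun i => (k i : ℝ)

theorem one_le_norm_latticeVec {d : ℕ} {k : Fin d → ℤ} (hk : k ≠ 0) : 1 ≤ ‖latticeVec k‖ := by
  obtain ⟨i, hi⟩ := Function.ne_iff.1 hk
  have h1 : ‖latticeVec k i‖ ≤ ‖latticeVec k‖ := PiLp.norm_apply_le _ i
  have h2 : (1 : ℝ) ≤ |(k i : ℝ)| := by exact_mod_cast Int.one_le_abs hi
  exact h2.trans h1

/-- A frequency is detected by a dyadic translation: along the coordinate in which `k` is largest,
the translation by `2⁻ʲ⁻²`, where `2ʲ ≤ |kᵢ| < 2ʲ⁺¹`, turns the character by at least a quarter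
turn and at most half a turn. -/
theorem exists_one_le_norm_mFourier_sub_one {d : ℕ} {k : Fin d → ℤ} (hk : k ≠ 0) :
    ∃ (i : Fin d) (j : ℕ), ‖latticeVec k‖ ≤ 2 * d * 2 ^ j ∧
      1 ≤ ‖UnitAddTorus.mFourier (-k)
        (torusProj (EuclideanSpace.single i (1 / 2 ^ (j + 2)))) - 1‖ := by
  have hne : (Finset.univ : Finset (Fin d)).Nonempty := by
    obtain ⟨i, -⟩ := Function.ne_iff.1 hk
    exact ⟨i, Finset.mem_univ i⟩
  obtain ⟨i, -, hi⟩ := Finset.exists_max_image Finset.univ (fun i => |k i|) hne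
  have hki : k i ≠ 0 := fun h => hk <| funext fun l => by
    have := hi l (Finset.mem_univ l)
    rw [h, abs_zero] at this
    exact abs_nonpos_iff.1 this
  have hn : (k i).natAbs ≠ 0 := Int.natAbs_ne_zero.2 hki
  set j := Nat.log 2 (k i).natAbs
  have hj1 : (2 : ℝ) ^ j ≤ |(k i : ℝ)| := by
    have := Nat.pow_log_le_self 2 hn
    rw [← Int.cast_abs, Int.abs_eq_natAbs]
    exact_mod_cast this
  have hj2 : |(k i : ℝ)| < 2 ^ (j + 1) := by
    have := Nat.lt_pow_succ_log_self (b := 2) (by norm_num) (k i).natAbs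
    rw [← Int.cast_abs, Int.abs_eq_natAbs]
    exact_mod_cast this
  refine ⟨i, j, ?_, ?_⟩
  · calc ‖latticeVec k‖ ≤ ∑ l, |(k l : ℝ)| := by
          rw [EuclideanSpace.norm_eq]
          refine Real.sqrt_le_iff.2 ⟨Finset.sum_nonneg fun l _ => abs_nonneg _, ?_⟩
          exact Finset.sum_sq_le_sq_sum_of_nonneg fun l _ => abs_nonneg _
      _ ≤ ∑ l : Fin d, (2 : ℝ) ^ (j + 1) := Finset.sum_le_sum fun l _ => by
          have : |(k l : ℝ)| ≤ |(k i : ℝ)| := by exact_mod_cast hi l (Finset.mem_univ l)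
          linarith
      _ = 2 * d * 2 ^ j := by simp; ring
  · rw [mFourier_torusProj]
    have hsum : ∑ l, ((-k) l : ℝ) *
        (EuclideanSpace.single i ((1 : ℝ) / 2 ^ (j + 2)) : EuclideanSpace ℝ (Fin d)) l =
        -(k i : ℝ) / 2 ^ (j + 2) := by
      rw [Finset.sum_eq_single i]
      · simp [div_eq_mul_inv]
      · intro l _ hl; simp [hl]
      · simp
    rw [hsum]
    set φ := 2 * Real.pi * (-(k i : ℝ) / 2 ^ (j + 2))
    have hφ : |φ| = 2 * Real.pi * (|(k i : ℝ)| / 2 ^ (j + 2)) := by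
      simp only [φ, abs_mul, abs_div, abs_neg, abs_pow, abs_two, abs_of_pos Real.pi_pos]
    have hq1 : 1 / 4 ≤ |(k i : ℝ)| / 2 ^ (j + 2) := by
      rw [le_div_iff₀ (by positivity)]; rw [pow_add]; linarith
    have hq2 : |(k i : ℝ)| / 2 ^ (j + 2) ≤ 1 / 2 := by
      rw [div_le_iff₀ (by positivity)]; rw [pow_add] at hj2 ⊢; linarith
    have hcos : Real.cos φ ≤ 0 := by
      rw [← Real.cos_abs, hφ]
      have := Real.pi_pos
      apply Real.cos_nonpos_of_pi_div_two_le_of_le <;> nlinarith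
    have hre := Complex.abs_re_le_norm (Complex.exp (φ * Complex.I) - 1)
    rw [Complex.sub_re, Complex.exp_ofReal_mul_I_re, Complex.one_re] at hre
    have := neg_le_abs (Real.cos φ - 1)
    linarith

/-- The indicator functions of shells are bounded in the Sobolev spaces of order less than `1/2`. -/
theorem exists_tsum_sobolev_le (d : ℕ) (hd : d ≠ 0) {η : ℝ} (hη : 0 < η) (hη1 : η < 1) :
    ∃ B : ℝ, 0 < B ∧ ∀ s t : ℝ,
      Summable (fun k => ‖UnitAddTorus.mFourierCoeff (shellIndicator d s t) k‖ ^ 2 *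
        ‖latticeVec k‖ ^ (1 - η)) ∧
      ∑' k, ‖UnitAddTorus.mFourierCoeff (shellIndicator d s t) k‖ ^ 2 *
        ‖latticeVec k‖ ^ (1 - η) ≤ B := by
  obtain ⟨C, hC, hmod⟩ := exists_tsum_mFourier_sub_one_le d hd
  have hgeo : Summable fun j : ℕ => ((2 : ℝ) ^ (-η)) ^ j :=
    summable_geometric_of_lt_one (by positivity)
      (Real.rpow_lt_one_of_one_lt_of_neg one_lt_two (by linarith))
  set G := ∑' j : ℕ, ((2 : ℝ) ^ (-η)) ^ j
  have hG : 0 ≤ G := tsum_nonneg fun j => by positivity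
  refine ⟨2 * d * (d * (C * G)) + 1, by positivity, fun s t => ?_⟩
  set c := fun k => ‖UnitAddTorus.mFourierCoeff (shellIndicator d s t) k‖ ^ 2
  set e := fun (i : Fin d) (j : ℕ) (k : Fin d → ℤ) => ‖UnitAddTorus.mFourier (-k)
        (torusProj (EuclideanSpace.single i (1 / 2 ^ (j + 2)))) - 1‖ ^ 2
  -- The weight `|k| ^ (1 - η)` is dominated by a sum over dyadic translations, so that the sum over
  -- `k` may be carried out for one translation at a time.
  have hpt : ∀ k, ENNReal.ofReal (c k * ‖latticeVec k‖ ^ (1 - η)) ≤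
      ENNReal.ofReal (2 * d) * ∑ i, ∑' j : ℕ, ENNReal.ofReal (((2 : ℝ) ^ (1 - η)) ^ j) *
        ENNReal.ofReal (e i j k * c k) := by
    intro k
    rcases eq_or_ne k 0 with rfl | hk
    · have : latticeVec (0 : Fin d → ℤ) = 0 := by ext i; simp [latticeVec]
      rw [this, norm_zero, Real.zero_rpow (by linarith), mul_zero, ENNReal.ofReal_zero]
      exact zero_le
    obtain ⟨i, j, h1, h2⟩ := exists_one_le_norm_mFourier_sub_one hk
    have hd1 : (1 : ℝ) ≤ 2 * d := by
      have : (1 : ℝ) ≤ d := by exact_mod_cast Nat.one_le_iff_ne_zero.2 hd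
      linarith
    have hw : ‖latticeVec k‖ ^ (1 - η) ≤ 2 * d * ((2 : ℝ) ^ (1 - η)) ^ j := by
      calc ‖latticeVec k‖ ^ (1 - η) ≤ (2 * d * 2 ^ j) ^ (1 - η) := by
            gcongr
        _ = (2 * d) ^ (1 - η) * ((2 : ℝ) ^ (1 - η)) ^ j := by
            rw [Real.mul_rpow (by positivity) (by positivity), ← Real.rpow_natCast,
              ← Real.rpow_natCast, ← Real.rpow_mul (by norm_num), ← Real.rpow_mul (by norm_num),
              mul_comm (j : ℝ)]
        _ ≤ (2 * d) ^ (1 : ℝ) * ((2 : ℝ) ^ (1 - η)) ^ j := by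
            gcongr
            linarith
        _ = _ := by rw [Real.rpow_one]
    have he : 1 ≤ e i j k := one_le_pow₀ h2
    calc ENNReal.ofReal (c k * ‖latticeVec k‖ ^ (1 - η))
        ≤ ENNReal.ofReal (2 * d * (((2 : ℝ) ^ (1 - η)) ^ j * (e i j k * c k))) := by
          refine ENNReal.ofReal_le_ofReal ?_
          have hc : 0 ≤ c k := by positivity
          calc c k * ‖latticeVec k‖ ^ (1 - η) ≤ c k * (2 * d * ((2 : ℝ) ^ (1 - η)) ^ j) := by
                gcongr
            _ = 2 * d * (((2 : ℝ) ^ (1 - η)) ^ j * (1 * c k)) := by ring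
            _ ≤ _ := by gcongr
      _ = ENNReal.ofReal (2 * d) * (ENNReal.ofReal (((2 : ℝ) ^ (1 - η)) ^ j) *
          ENNReal.ofReal (e i j k * c k)) := by
          rw [ENNReal.ofReal_mul (p := 2 * d) (by positivity),
            ENNReal.ofReal_mul (p := ((2 : ℝ) ^ (1 - η)) ^ j) (by positivity)]
      _ ≤ _ := by
          gcongr
          refine le_trans ?_ (Finset.single_le_sum (f := fun i => ∑' j : ℕ,
            ENNReal.ofReal (((2 : ℝ) ^ (1 - η)) ^ j) * ENNReal.ofReal (e i j k * c k))
            (fun _ _ => zero_le) (Finset.mem_univ i))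
          exact ENNReal.le_tsum (f := fun j : ℕ =>
            ENNReal.ofReal (((2 : ℝ) ^ (1 - η)) ^ j) * ENNReal.ofReal (e i j k * c k)) j
  have hsum : ∑' k, ENNReal.ofReal (c k * ‖latticeVec k‖ ^ (1 - η)) ≤
      ENNReal.ofReal (2 * d * (d * (C * G)) + 1) := by
    calc ∑' k, ENNReal.ofReal (c k * ‖latticeVec k‖ ^ (1 - η))
        ≤ ∑' k, ENNReal.ofReal (2 * d) * ∑ i, ∑' j : ℕ, ENNReal.ofReal (((2 : ℝ) ^ (1 - η)) ^ j) *
            ENNReal.ofReal (e i j k * c k) := ENNReal.tsum_le_tsum hpt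
      _ = ENNReal.ofReal (2 * d) * ∑ i, ∑' j : ℕ, ENNReal.ofReal (((2 : ℝ) ^ (1 - η)) ^ j) *
            ∑' k, ENNReal.ofReal (e i j k * c k) := by
          rw [ENNReal.tsum_mul_left, Summable.tsum_finsetSum fun _ _ => ENNReal.summable]
          congr 1
          refine Finset.sum_congr rfl fun i _ => ?_
          rw [ENNReal.tsum_comm]
          simp only [ENNReal.tsum_mul_left]
      _ ≤ ENNReal.ofReal (2 * d) * ∑ i : Fin d, ∑' j : ℕ,
            ENNReal.ofReal (C * ((2 : ℝ) ^ (-η)) ^ j) := by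
          gcongr with i _ j
          refine (mul_le_mul_right (hmod s t _) _).trans ?_
          rw [← ENNReal.ofReal_mul (by positivity)]
          refine ENNReal.ofReal_le_ofReal ?_
          have hpow : ((2 : ℝ) ^ (1 - η)) ^ j = ((2 : ℝ) ^ (-η)) ^ j * 2 ^ j := by
            rw [← mul_pow, sub_eq_add_neg, Real.rpow_add two_pos, Real.rpow_one, mul_comm]
          rw [hpow, PiLp.norm_single, Real.norm_of_nonneg (by positivity), pow_add]
          have h2 : (2 : ℝ) ^ j ≠ 0 := by positivity
          have : ((2 : ℝ) ^ (-η)) ^ j * 2 ^ j * (C * (1 / (2 ^ j * 2 ^ 2))) =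
            C * ((2 : ℝ) ^ (-η)) ^ j / 4 := by field_simp; norm_num
          rw [this]
          exact div_le_self (by positivity) (by norm_num)
      _ = ENNReal.ofReal (2 * d * (d * (C * G))) := by
          rw [← ENNReal.ofReal_tsum_of_nonneg (fun j => by positivity) (hgeo.mul_left C),
            tsum_mul_left, Finset.sum_const, Finset.card_univ, Fintype.card_fin, nsmul_eq_mul,
            ENNReal.ofReal_mul (p := 2 * d) (by positivity),
            ENNReal.ofReal_mul (p := (d : ℝ)) (by positivity),
            ENNReal.ofReal_natCast]
      _ ≤ _ := ENNReal.ofReal_le_ofReal (by linarith)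
  have hnn : ∀ k, 0 ≤ c k * ‖latticeVec k‖ ^ (1 - η) := fun k => by positivity
  have hS : Summable fun k => c k * ‖latticeVec k‖ ^ (1 - η) := by
    have := ENNReal.summable_toReal (hsum.trans_lt ENNReal.ofReal_lt_top).ne
    simpa only [ENNReal.toReal_ofReal (hnn _)] using this
  refine ⟨hS, ?_⟩
  rw [← ENNReal.ofReal_tsum_of_nonneg hnn hS] at hsum
  exact (ENNReal.ofReal_le_ofReal_iff (by positivity)).1 hsum

/-! ### Smoothing at scale `δ` -/

/-- A smooth nonnegative function on `ℝᵈ` with integral `1` that vanishes outside the unit ball. -/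
noncomputable def unitBump (d : ℕ) : EuclideanSpace ℝ (Fin d) → ℝ :=
  ContDiffBump.normed (⟨1 / 2, 1, by norm_num, by norm_num⟩ :
    ContDiffBump (0 : EuclideanSpace ℝ (Fin d))) volume

theorem unitBump_nonneg {d : ℕ} (y : EuclideanSpace ℝ (Fin d)) : 0 ≤ unitBump d y :=
  ContDiffBump.nonneg_normed _ _

theorem contDiff_unitBump (d : ℕ) : ContDiff ℝ ((⊤ : ℕ∞) : WithTop ℕ∞) (unitBump d) :=
  ContDiffBump.contDiff_normed _

theorem continuous_unitBump (d : ℕ) : Continuous (unitBump d) :=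
  (contDiff_unitBump d).continuous

theorem hasCompactSupport_unitBump (d : ℕ) : HasCompactSupport (unitBump d) :=
  ContDiffBump.hasCompactSupport_normed _

theorem integrable_unitBump (d : ℕ) : Integrable (unitBump d) :=
  ContDiffBump.integrable_normed _

theorem integral_unitBump (d : ℕ) : ∫ y, unitBump d y = 1 :=
  ContDiffBump.integral_normed _

theorem norm_lt_one_of_unitBump_ne_zero {d : ℕ} {y : EuclideanSpace ℝ (Fin d)}
    (hy : unitBump d y ≠ 0) : ‖y‖ < 1 := by
  have h : y ∈ Function.support (unitBump d) := hy
  rw [unitBump, ContDiffBump.support_normed_eq] at h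
  simpa using h

/-- The Fourier transform of `unitBump` at `δ k`: the factor by which smoothing at scale `δ`
multiplies the Fourier coefficient of frequency `k`. -/
noncomputable def bumpMultiplier {d : ℕ} (δ : ℝ) (k : Fin d → ℤ) : ℂ :=
  ∫ y, (unitBump d y : ℂ) * UnitAddTorus.mFourier (-k) (torusProj (δ • y))

theorem bumpMultiplier_zero {d : ℕ} (δ : ℝ) : bumpMultiplier δ (0 : Fin d → ℤ) = 1 := by
  simp only [bumpMultiplier, neg_zero, UnitAddTorus.mFourier_zero, ContinuousMap.one_apply, mul_one]
  rw [integral_complex_ofReal, integral_unitBump, Complex.ofReal_one]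

open FourierTransform in
/-- `bumpMultiplier` decays faster than any power of `δ |k|`, since the Fourier transform of a
smooth function of compact support is a Schwartz function. -/
theorem exists_norm_bumpMultiplier_mul_rpow_le (d : ℕ) {p : ℝ} (hp : 0 ≤ p) :
    ∃ C : ℝ, 0 < C ∧ ∀ (δ : ℝ), 0 < δ → ∀ k : Fin d → ℤ,
      ‖bumpMultiplier δ k‖ * (δ * ‖latticeVec k‖) ^ p ≤ C := by
  have hcs : HasCompactSupport fun y => (unitBump d y : ℂ) :=
    (hasCompactSupport_unitBump d).comp_left Complex.ofReal_zero
  have hcd : ContDiff ℝ ((⊤ : ℕ∞) : WithTop ℕ∞) fun y => (unitBump d y : ℂ) :=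
    Complex.ofRealCLM.contDiff.comp (contDiff_unitBump d)
  set Ψ : SchwartzMap (EuclideanSpace ℝ (Fin d)) ℂ := hcs.toSchwartzMap hcd
  have hΨ : ∀ δ (k : Fin d → ℤ), bumpMultiplier δ k = 𝓕 Ψ (δ • latticeVec k) := by
    intro δ k
    rw [SchwartzMap.fourier_coe, Real.fourier_eq']
    refine integral_congr_ae (Eventually.of_forall fun y => ?_)
    change (unitBump d y : ℂ) * _ = _ • (unitBump d y : ℂ)
    rw [mFourier_torusProj, smul_eq_mul, mul_comm]
    congr 4
    simp only [latticeVec, inner_smul_right, PiLp.inner_apply, Pi.neg_apply, PiLp.smul_apply,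
      RCLike.inner_apply, conj_trivial, smul_eq_mul, Int.cast_neg, Finset.mul_sum]
    rw [← Finset.sum_congr rfl fun i _ => ?_]
    ring
  obtain ⟨M, hM⟩ := exists_nat_ge p
  obtain ⟨C0, hC0, h0⟩ := (𝓕 Ψ).decay 0 0
  obtain ⟨C1, hC1, h1⟩ := (𝓕 Ψ).decay M 0
  refine ⟨C0 + C1, by positivity, fun δ hδ k => ?_⟩
  have hn : δ * ‖latticeVec k‖ = ‖δ • latticeVec k‖ := by
    rw [norm_smul, Real.norm_of_nonneg hδ.le]
  rw [hΨ, hn]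
  set w := δ • latticeVec k
  have h0 := h0 w
  have h1 := h1 w
  simp only [pow_zero, one_mul, norm_iteratedFDeriv_zero] at h0 h1
  have hw : ‖w‖ ^ p ≤ 1 + ‖w‖ ^ M := by
    rcases le_total ‖w‖ 1 with h | h
    · have := Real.rpow_le_one (norm_nonneg w) h hp
      have : 0 ≤ ‖w‖ ^ M := by positivity
      linarith
    · have := Real.rpow_le_rpow_of_exponent_le h hM
      rw [Real.rpow_natCast] at this
      linarith
  calc ‖𝓕 Ψ w‖ * ‖w‖ ^ p ≤ ‖𝓕 Ψ w‖ * (1 + ‖w‖ ^ M) := by gcongr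
    _ = ‖𝓕 Ψ w‖ + ‖w‖ ^ M * ‖𝓕 Ψ w‖ := by ring
    _ ≤ C0 + C1 := add_le_add h0 h1

/-- The indicator function of a shell, averaged over translations of length at most `δ`. -/
noncomputable def smoothShell (d : ℕ) (s t δ : ℝ) (x : UnitAddTorus (Fin d)) : ℂ :=
  ∫ y, (unitBump d y : ℂ) * shellIndicator d s t (x - torusProj (δ • y))

theorem measurable_torusProj_smul {d : ℕ} (δ : ℝ) :
    Measurable fun y : EuclideanSpace ℝ (Fin d) => torusProj (δ • y) :=
  (continuous_torusProj.comp (continuous_const_smul δ)).measurable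

theorem integrable_unitBump_mul_shellIndicator (d : ℕ) (s t δ : ℝ) (x : UnitAddTorus (Fin d)) :
    Integrable fun y => (unitBump d y : ℂ) * shellIndicator d s t (x - torusProj (δ • y)) := by
  refine ((integrable_unitBump d).ofReal (𝕜 := ℂ)).mul_bdd (c := 1) ?_
    (Eventually.of_forall fun y => norm_shellIndicator_le _ _ _ _)
  exact ((measurable_shellIndicator d s t).comp
    (measurable_const.sub (measurable_torusProj_smul δ))).aestronglyMeasurable

theorem re_smoothShell (d : ℕ) (s t δ : ℝ) (x : UnitAddTorus (Fin d)) :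
    (smoothShell d s t δ x).re =
      ∫ y, unitBump d y * (shellIndicator d s t (x - torusProj (δ • y))).re := by
  have h := integral_re (integrable_unitBump_mul_shellIndicator d s t δ x)
  simp only [RCLike.re_eq_complex_re, Complex.re_ofReal_mul] at h
  exact h.symm

theorem re_shellIndicator_mem_Icc (d : ℕ) (s t : ℝ) (x : UnitAddTorus (Fin d)) :
    (shellIndicator d s t x).re ∈ Icc (0 : ℝ) 1 := by
  by_cases h : x ∈ torusShell d s t <;> simp [shellIndicator, h]

theorem re_smoothShell_nonneg (d : ℕ) (s t δ : ℝ) (x : UnitAddTorus (Fin d)) :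
    0 ≤ (smoothShell d s t δ x).re := by
  rw [re_smoothShell]
  exact integral_nonneg fun y =>
    mul_nonneg (unitBump_nonneg y) (re_shellIndicator_mem_Icc d s t _).1

theorem re_smoothShell_le_one (d : ℕ) (s t δ : ℝ) (x : UnitAddTorus (Fin d)) :
    (smoothShell d s t δ x).re ≤ 1 := by
  rw [re_smoothShell]
  refine le_of_le_of_eq ?_ (integral_unitBump d)
  refine integral_mono_of_nonneg (Eventually.of_forall fun y =>
    mul_nonneg (unitBump_nonneg y) (re_shellIndicator_mem_Icc d s t _).1) (integrable_unitBump d)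
    (Eventually.of_forall fun y =>
      mul_le_of_le_one_right (unitBump_nonneg y) (re_shellIndicator_mem_Icc d s t _).2)

theorem torusNorm_sub_torusProj_smul_mem {d : ℕ} {δ : ℝ} (hδ : 0 ≤ δ) (x : UnitAddTorus (Fin d))
    {y : EuclideanSpace ℝ (Fin d)} (hy : unitBump d y ≠ 0) :
    torusNorm x - δ ≤ torusNorm (x - torusProj (δ • y)) ∧
      torusNorm (x - torusProj (δ • y)) ≤ torusNorm x + δ := by
  have h := torusNorm_sub_torusProj_mem x (δ • y)
  have h1 : ‖δ • y‖ ≤ δ := by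
    rw [norm_smul, Real.norm_of_nonneg hδ]
    exact mul_le_of_le_one_right hδ (norm_lt_one_of_unitBump_ne_zero hy).le
  constructor <;> linarith

theorem smoothShell_eq_one {d : ℕ} {s t δ : ℝ} (hδ : 0 ≤ δ) {x : UnitAddTorus (Fin d)}
    (hx : x ∈ torusShell d (s + δ) (t - δ)) : smoothShell d s t δ x = 1 := by
  have h : ∀ y, (unitBump d y : ℂ) * shellIndicator d s t (x - torusProj (δ • y)) =
      (unitBump d y : ℂ) := by
    intro y
    by_cases hy : unitBump d y = 0
    · simp [hy]
    · have h1 := torusNorm_sub_torusProj_smul_mem hδ x hy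
      have h2 : x - torusProj (δ • y) ∈ torusShell d s t :=
        ⟨by linarith [hx.1], by linarith [hx.2]⟩
      simp [shellIndicator, h2]
  simp only [smoothShell, h]
  rw [integral_complex_ofReal, integral_unitBump, Complex.ofReal_one]

theorem smoothShell_eq_zero {d : ℕ} {s t δ : ℝ} (hδ : 0 ≤ δ) {x : UnitAddTorus (Fin d)}
    (hx : x ∉ torusShell d (s - δ) (t + δ)) : smoothShell d s t δ x = 0 := by
  have h : ∀ y, (unitBump d y : ℂ) * shellIndicator d s t (x - torusProj (δ • y)) = 0 := by
    intro y
    by_cases hy : unitBump d y = 0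
    · simp [hy]
    · have h1 := torusNorm_sub_torusProj_smul_mem hδ x hy
      have h2 : x - torusProj (δ • y) ∉ torusShell d s t := fun h2 =>
        hx ⟨by linarith [h2.1], by linarith [h2.2]⟩
      simp [shellIndicator, h2]
  simp only [smoothShell, h, integral_zero]

/-- Lifted to `ℝᵈ`, `smoothShell` is the convolution of a bounded function with a continuous
function of compact support. -/
theorem continuous_smoothShell (d : ℕ) (s t : ℝ) {δ : ℝ} (hδ : 0 < δ) :
    Continuous (smoothShell d s t δ) := by
  rw [isOpenQuotientMap_torusProj.isQuotientMap.continuous_iff]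
  set φ : EuclideanSpace ℝ (Fin d) → ℂ := fun y => (unitBump d (δ⁻¹ • y) : ℂ)
  set g : EuclideanSpace ℝ (Fin d) → ℂ := fun y => shellIndicator d s t (torusProj y)
  have hφ : Continuous φ :=
    Complex.continuous_ofReal.comp ((continuous_unitBump d).comp (continuous_const_smul _))
  have hφc : HasCompactSupport φ :=
    ((hasCompactSupport_unitBump d).comp_smul (inv_ne_zero hδ.ne')).comp_left Complex.ofReal_zero
  have hg : LocallyIntegrable g :=
    (memLp_top_of_bound ((measurable_shellIndicator d s t).comp
      continuous_torusProj.measurable).aestronglyMeasurable 1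
      (Eventually.of_forall fun y => norm_shellIndicator_le _ _ _ _)).locallyIntegrable le_top
  have hconv := hφc.continuous_convolution_left (ContinuousLinearMap.mul ℝ ℂ) hφ hg
  have heq : smoothShell d s t δ ∘ torusProj = fun z =>
      |(δ ^ Module.finrank ℝ (EuclideanSpace ℝ (Fin d)))⁻¹| •
        (convolution φ g (ContinuousLinearMap.mul ℝ ℂ) volume z) := by
    ext z
    rw [convolution_def, ← Measure.integral_comp_smul]
    refine integral_congr_ae (Eventually.of_forall fun y => ?_)
    simp only [φ, g, ContinuousLinearMap.mul_apply', torusProj_sub, smul_smul,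
      inv_mul_cancel₀ hδ.ne', one_smul]
  rw [heq]
  exact hconv.const_smul (|(δ ^ Module.finrank ℝ (EuclideanSpace ℝ (Fin d)))⁻¹| : ℝ)

/-- Averaging over translations multiplies Fourier coefficients, by Fubini's theorem. -/
theorem mFourierCoeff_smoothShell (d : ℕ) (s t δ : ℝ) (k : Fin d → ℤ) :
    UnitAddTorus.mFourierCoeff (smoothShell d s t δ) k =
      UnitAddTorus.mFourierCoeff (shellIndicator d s t) k * bumpMultiplier δ k := by
  have hint : Integrable (Function.uncurry fun (x : UnitAddTorus (Fin d))
      (y : EuclideanSpace ℝ (Fin d)) => UnitAddTorus.mFourier (-k) x *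
        ((unitBump d y : ℂ) * shellIndicator d s t (x - torusProj (δ • y))))
      (volume.prod volume) := by
    have h0 : Integrable (fun p : UnitAddTorus (Fin d) × EuclideanSpace ℝ (Fin d) =>
        unitBump d p.2) (volume.prod volume) := (integrable_unitBump d).comp_snd volume
    refine h0.mono' ?_ (Eventually.of_forall fun p => ?_)
    · refine Measurable.aestronglyMeasurable (Measurable.mul ?_ (Measurable.mul ?_ ?_))
      · exact (UnitAddTorus.mFourier (-k)).continuous.measurable.comp measurable_fst
      · exact (Complex.continuous_ofReal.comp
          (continuous_unitBump d)).measurable.comp measurable_snd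
      · exact (measurable_shellIndicator d s t).comp
          (measurable_fst.sub ((measurable_torusProj_smul δ).comp measurable_snd))
    · simp only [Function.uncurry, norm_mul, norm_mFourier_apply, one_mul, Complex.norm_real,
        Real.norm_of_nonneg (unitBump_nonneg p.2)]
      exact mul_le_of_le_one_right (unitBump_nonneg _) (norm_shellIndicator_le _ _ _ _)
  rw [mFourierCoeff_eq_integral_volume]
  simp only [smoothShell, ← integral_const_mul]
  rw [integral_integral_swap hint, bumpMultiplier, ← integral_const_mul]
  refine integral_congr_ae (Eventually.of_forall fun y => ?_)
  have h := mFourierCoeff_comp_sub (shellIndicator d s t) (torusProj (δ • y)) k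
  rw [mFourierCoeff_eq_integral_volume] at h
  calc ∫ x, UnitAddTorus.mFourier (-k) x *
        ((unitBump d y : ℂ) * shellIndicator d s t (x - torusProj (δ • y)))
      = (unitBump d y : ℂ) * ∫ x, UnitAddTorus.mFourier (-k) x *
          shellIndicator d s t (x - torusProj (δ • y)) := by
        rw [← integral_const_mul]
        congr 1 with x
        ring
    _ = _ := by rw [h]; ring

theorem mFourierCoeff_shellIndicator_zero (d : ℕ) (s t : ℝ) :
    UnitAddTorus.mFourierCoeff (shellIndicator d s t) 0 = volume.real (torusShell d s t) := by
  rw [mFourierCoeff_eq_integral_volume]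
  simp only [neg_zero, UnitAddTorus.mFourier_zero, ContinuousMap.one_apply, one_mul]
  rw [shellIndicator, integral_indicator (measurableSet_torusShell d s t)]
  simp

theorem summable_norm_latticeVec_rpow (d : ℕ) {r : ℝ} (hr : r < -d) :
    Summable fun k : Fin d → ℤ => ‖latticeVec k‖ ^ r := by
  set b := (EuclideanSpace.basisFun (Fin d) ℝ).toBasis
  set Λ := Submodule.span ℤ (Set.range b)
  have hmem : ∀ k : Fin d → ℤ, latticeVec k ∈ Λ := by
    intro k
    refine (b.mem_span_iff_repr_mem ℤ _).2 fun i => ?_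
    exact ⟨k i, by simp [b, latticeVec]⟩
  have hrank : Module.finrank ℤ Λ = d := by
    rw [ZLattice.rank ℝ Λ, finrank_euclideanSpace_fin]
  have h := ZLattice.summable_norm_rpow Λ r (by rw [hrank]; exact hr)
  refine h.comp_injective (i := fun k => (⟨latticeVec k, hmem k⟩ : Λ)) fun k l hkl => ?_
  ext i
  have := congrArg (fun z : Λ => (z : EuclideanSpace ℝ (Fin d)) i) hkl
  simpa [latticeVec] using this

/-- By the arithmetic–geometric mean inequality, a weighted `ℓ¹` norm of the Fourier coefficients of
a smoothed shell is controlled by a Sobolev norm of the shell and by the decay of the multiplier. -/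
theorem exists_tsum_norm_mFourierCoeff_smoothShell_le (d : ℕ) (hd : d ≠ 0) {ε : ℝ} (hε : 0 < ε)
    (hε1 : ε < 1 / 2) :
    ∃ C : ℝ, 0 < C ∧ ∀ s t δ : ℝ, 0 < δ →
      Summable (fun k => ‖UnitAddTorus.mFourierCoeff (smoothShell d s t δ) k‖ *
        ‖latticeVec k‖ ^ (2 * ε)) ∧
      ∑' k, ‖UnitAddTorus.mFourierCoeff (smoothShell d s t δ) k‖ * ‖latticeVec k‖ ^ (2 * ε) ≤
        C * δ ^ (-(((d : ℝ) - 1) / 2 + 4 * ε)) := by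
  have hd1 : (1 : ℝ) ≤ d := by exact_mod_cast Nat.one_le_iff_ne_zero.2 hd
  set p := ((d : ℝ) - 1) / 2 + 4 * ε with hp
  have hp0 : 0 ≤ p := by
    have : 0 ≤ ((d : ℝ) - 1) / 2 := by linarith
    linarith
  obtain ⟨B, hB, hsob⟩ := exists_tsum_sobolev_le d hd (η := 2 * ε) (by linarith) (by linarith)
  obtain ⟨K, hK, hmul⟩ := exists_norm_bumpMultiplier_mul_rpow_le d hp0
  have hlat := summable_norm_latticeVec_rpow d (r := -d - 2 * ε) (by linarith)
  set T := ∑' k : Fin d → ℤ, ‖latticeVec k‖ ^ (-(d : ℝ) - 2 * ε)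
  have hT : 0 ≤ T := tsum_nonneg fun k => by positivity
  refine ⟨B + K ^ 2 * T, by positivity, fun s t δ hδ => ?_⟩
  obtain ⟨hs1, hs2⟩ := hsob s t
  set X := fun k => ‖UnitAddTorus.mFourierCoeff (shellIndicator d s t) k‖
  have hpt : ∀ k, ‖UnitAddTorus.mFourierCoeff (smoothShell d s t δ) k‖ *
      ‖latticeVec k‖ ^ (2 * ε) ≤ δ ^ (-p) * (X k ^ 2 * ‖latticeVec k‖ ^ (1 - 2 * ε) +
        K ^ 2 * ‖latticeVec k‖ ^ (-(d : ℝ) - 2 * ε)) := by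
    intro k
    rcases eq_or_ne k 0 with rfl | hk
    · have : latticeVec (0 : Fin d → ℤ) = 0 := by ext i; simp [latticeVec]
      rw [this, norm_zero, Real.zero_rpow (by linarith), mul_zero]
      positivity
    have hn : 0 < ‖latticeVec k‖ := one_pos.trans_le (one_le_norm_latticeVec hk)
    have hm := hmul δ hδ k
    rw [mFourierCoeff_smoothShell, norm_mul]
    set n := ‖latticeVec k‖
    have hY : ‖bumpMultiplier δ k‖ ≤ K * (δ ^ (-p) * n ^ (-p)) := by
      rw [← Real.mul_rpow hδ.le hn.le, Real.rpow_neg (by positivity), ← div_eq_mul_inv,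
        le_div_iff₀ (by positivity)]
      exact hm
    -- Up to the factor `δ ^ (-p)`, the `k`-th term is at most `P * Q` with `P ^ 2` summable by the
    -- Sobolev bound and `Q ^ 2` a multiple of `|k| ^ (-d - 2ε)`.
    set P := X k * n ^ (1 / 2 - ε) with hP
    set Q := K * n ^ (-(d : ℝ) / 2 - ε) with hQ
    have hP2 : P ^ 2 = X k ^ 2 * n ^ (1 - 2 * ε) := by
      rw [hP, mul_pow, ← Real.rpow_natCast (n ^ _), ← Real.rpow_mul hn.le]
      congr 2; push_cast; ring
    have hQ2 : Q ^ 2 = K ^ 2 * n ^ (-(d : ℝ) - 2 * ε) := by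
      rw [hQ, mul_pow, ← Real.rpow_natCast (n ^ _), ← Real.rpow_mul hn.le]
      congr 2; push_cast; ring
    calc X k * ‖bumpMultiplier δ k‖ * n ^ (2 * ε)
        ≤ X k * (K * (δ ^ (-p) * n ^ (-p))) * n ^ (2 * ε) := by
          have : 0 ≤ X k := norm_nonneg _
          gcongr
      _ = δ ^ (-p) * (P * Q) := by
          have : n ^ (-p) * n ^ (2 * ε) = n ^ (1 / 2 - ε) * n ^ (-(d : ℝ) / 2 - ε) := by
            rw [← Real.rpow_add hn, ← Real.rpow_add hn]
            congr 1; rw [hp]; ring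
          rw [hP, hQ]
          linear_combination X k * K * δ ^ (-p) * this
      _ ≤ δ ^ (-p) * (P ^ 2 + Q ^ 2) := by
          gcongr
          nlinarith [sq_nonneg (P - Q), sq_nonneg P, sq_nonneg Q]
      _ = _ := by rw [hP2, hQ2]
  have hmaj := (hs1.add (hlat.mul_left (K ^ 2))).mul_left (δ ^ (-p))
  have hsum := Summable.of_nonneg_of_le (fun k => by positivity) hpt hmaj
  refine ⟨hsum, (hsum.tsum_le_tsum hpt hmaj).trans ?_⟩
  rw [tsum_mul_left, hs1.tsum_add (hlat.mul_left _), tsum_mul_left, mul_comm]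
  gcongr

/-! ### Counting pairs -/

/-- Fourier expansion of a pair sum, in which the characters combine to `|∑ₙ e(k · vₙ)|²`. -/
theorem hasSum_sum_smoothShell {d : ℕ} {s t δ : ℝ} (hδ : 0 < δ)
    (hs : Summable (UnitAddTorus.mFourierCoeff (smoothShell d s t δ)))
    (v : ℕ → UnitAddTorus (Fin d)) (N : ℕ) :
    HasSum (fun k => UnitAddTorus.mFourierCoeff (smoothShell d s t δ) k *
        (‖∑ n ∈ Finset.Icc 1 N, UnitAddTorus.mFourier k (v n)‖ ^ 2 : ℝ))
      (∑ n ∈ Finset.Icc 1 N, ∑ m ∈ Finset.Icc 1 N, smoothShell d s t δ (v n - v m)) := by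
  have h := fun x => UnitAddTorus.hasSum_mFourier_series_apply_of_summable
    (f := ⟨smoothShell d s t δ, continuous_smoothShell d s t hδ⟩) hs x
  have h2 := hasSum_sum fun n (_ : n ∈ Finset.Icc 1 N) =>
    hasSum_sum fun m (_ : m ∈ Finset.Icc 1 N) => h (v n - v m)
  refine HasSum.congr_fun h2 fun k => ?_
  rw [Complex.ofReal_pow, ← Complex.mul_conj', map_sum, Finset.sum_mul_sum, Finset.mul_sum]
  refine Finset.sum_congr rfl fun n _ => ?_
  rw [Finset.mul_sum]
  refine Finset.sum_congr rfl fun m _ => ?_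
  rw [sub_eq_add_neg, mFourier_apply_add, mFourier_apply_neg, UnitAddTorus.mFourier_neg,
    smul_eq_mul]
  rfl

/-- The pair sum of a smoothed shell: the zero frequency gives the main term, and the exponential
sums at the other frequencies are bounded by the uniform distribution of the sequence. -/
theorem exists_norm_sum_smoothShell_sub_le {d : ℕ} (hd : d ≠ 0) {γ : ℝ}
    {v : ℕ → UnitAddTorus (Fin d)} (hv : IsGammaUniformlyDistributed γ v) {ε : ℝ} (hε : 0 < ε)
    (hε1 : ε < 1 / 2) :
    ∃ C : ℝ, 0 < C ∧ ∀ s t δ : ℝ, 0 < δ → ∀ N : ℕ, 1 ≤ N →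
      ‖∑ n ∈ Finset.Icc 1 N, ∑ m ∈ Finset.Icc 1 N, smoothShell d s t δ (v n - v m) -
        ((N : ℝ) ^ 2 * volume.real (torusShell d s t) : ℝ)‖ ≤
      C * ((N : ℝ) ^ (2 - 2 * γ) * δ ^ (-(((d : ℝ) - 1) / 2 + 4 * ε))) := by
  obtain ⟨K, hK⟩ := hv ε hε
  obtain ⟨C, hC, hsum⟩ := exists_tsum_norm_mFourierCoeff_smoothShell_le d hd hε hε1
  refine ⟨(K ^ 2 + 1) * C, by positivity, fun s t δ hδ N hN => ?_⟩
  obtain ⟨h1, h2⟩ := hsum s t δ hδ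
  set c := UnitAddTorus.mFourierCoeff (smoothShell d s t δ)
  have hN0 : (0 : ℝ) < N := by exact_mod_cast hN
  have hc : Summable c := by
    refine Summable.of_norm_bounded_eventually h1 ?_
    refine (Set.finite_singleton (0 : Fin d → ℤ)).subset fun k hk => ?_
    by_contra hk0
    exact hk (le_mul_of_one_le_right (norm_nonneg _)
      (Real.one_le_rpow (one_le_norm_latticeVec hk0) (by linarith)))
  have hS := hasSum_sum_smoothShell hδ hc v N
  set S := fun k => ∑ n ∈ Finset.Icc 1 N, UnitAddTorus.mFourier k (v n)
  have hc0 : c 0 = volume.real (torusShell d s t) := by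
    simp only [c]
    rw [mFourierCoeff_smoothShell, bumpMultiplier_zero, mul_one, mFourierCoeff_shellIndicator_zero]
  have hS0 : S 0 = N := by simp [S, UnitAddTorus.mFourier_zero]
  have hSk : ∀ k, k ≠ 0 →
      ‖S k‖ ^ 2 ≤ K ^ 2 * (N : ℝ) ^ (2 - 2 * γ) * ‖latticeVec k‖ ^ (2 * ε) := by
    intro k hk
    have h3 := hK k hk N hN
    change ‖1 / (N : ℂ) * S k‖ ≤ K * ‖latticeVec k‖ ^ ε * (N : ℝ) ^ (-γ) at h3
    rw [norm_mul, norm_div, norm_one, Complex.norm_natCast, one_div, inv_mul_le_iff₀ hN0] at h3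
    calc ‖S k‖ ^ 2 ≤ (N * (K * ‖latticeVec k‖ ^ ε * (N : ℝ) ^ (-γ))) ^ 2 := by gcongr
      _ = K ^ 2 * (N * (N : ℝ) ^ (-γ)) ^ 2 * (‖latticeVec k‖ ^ ε) ^ 2 := by ring
      _ = _ := by
        have e1 : ((N : ℝ) * (N : ℝ) ^ (-γ)) ^ 2 = (N : ℝ) ^ (2 - 2 * γ) := by
          nth_rewrite 1 [← Real.rpow_one (N : ℝ)]
          rw [← Real.rpow_add hN0, ← Real.rpow_natCast, ← Real.rpow_mul hN0.le]
          congr 1; push_cast; ring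
        have e2 : (‖latticeVec k‖ ^ ε) ^ 2 = ‖latticeVec k‖ ^ (2 * ε) := by
          rw [← Real.rpow_natCast, ← Real.rpow_mul (norm_nonneg _), mul_comm]
          norm_num
        rw [e1, e2]
  -- The zero frequency is removed from the series.
  have hS' := hS.sub (hasSum_ite_eq (0 : Fin d → ℤ) (c 0 * (‖S 0‖ ^ 2 : ℝ)))
  have hmain : c 0 * (‖S 0‖ ^ 2 : ℝ) = ((N : ℝ) ^ 2 * volume.real (torusShell d s t) : ℝ) := by
    rw [hc0, hS0, Complex.norm_natCast]; push_cast; ring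
  rw [hmain] at hS'
  have hbound := (h1.mul_left (K ^ 2 * (N : ℝ) ^ (2 - 2 * γ))).hasSum
  refine (hS'.norm_le_of_bounded hbound fun k => ?_).trans ?_
  · rcases eq_or_ne k 0 with rfl | hk
    · rw [if_pos rfl, hmain.symm, sub_self, norm_zero]
      positivity
    · rw [if_neg hk, sub_zero, norm_mul, Complex.norm_real, Real.norm_of_nonneg (by positivity)]
      calc ‖c k‖ * ‖S k‖ ^ 2
          ≤ ‖c k‖ * (K ^ 2 * (N : ℝ) ^ (2 - 2 * γ) * ‖latticeVec k‖ ^ (2 * ε)) := by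
            gcongr; exact hSk k hk
        _ = _ := by ring
  · rw [tsum_mul_left]
    calc K ^ 2 * (N : ℝ) ^ (2 - 2 * γ) * _
        ≤ (K ^ 2 + 1) * (N : ℝ) ^ (2 - 2 * γ) * (C * δ ^ (-(((d : ℝ) - 1) / 2 + 4 * ε))) := by
          gcongr; linarith
      _ = _ := by ring

theorem annulusCount_eq_sum {d : ℕ} (v : ℕ → UnitAddTorus (Fin d)) (a b : ℝ) (N : ℕ) :
    (annulusCount v a b N : ℝ) = ∑ n ∈ Finset.Icc 1 N, ∑ m ∈ Finset.Icc 1 N,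
      (torusShell d a b).indicator (1 : UnitAddTorus (Fin d) → ℝ) (v n - v m) := by
  classical
  have h : {p : ℕ × ℕ | p.1 ∈ Set.Icc 1 N ∧ p.2 ∈ Set.Icc 1 N ∧
      a ≤ torusNorm (v p.1 - v p.2) ∧ torusNorm (v p.1 - v p.2) ≤ b} =
      ((Finset.Icc 1 N ×ˢ Finset.Icc 1 N).filter
        fun p => v p.1 - v p.2 ∈ torusShell d a b : Finset (ℕ × ℕ)) := by
    ext p
    rw [Finset.mem_coe, Finset.mem_filter, Finset.mem_product, Finset.mem_Icc, Finset.mem_Icc,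
      and_assoc]
    rfl
  rw [annulusCount, h, Set.ncard_coe_finset, Finset.card_filter, Nat.cast_sum,
    Finset.sum_product]
  simp [indicator_apply]

/-- Smoothing at scale `δ` sandwiches the number of pairs between two pair sums of smoothed shells
whose main terms differ from the volume of the given shell by `O(δ)`. -/
theorem exists_abs_annulusCount_sub_le {d : ℕ} (hd : d ≠ 0) {γ : ℝ}
    {v : ℕ → UnitAddTorus (Fin d)} (hv : IsGammaUniformlyDistributed γ v) {ε : ℝ} (hε : 0 < ε)
    (hε1 : ε < 1 / 2) :
    ∃ C : ℝ, 0 < C ∧ ∀ a b δ : ℝ, 0 < δ → ∀ N : ℕ, 1 ≤ N →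
      |(annulusCount v a b N : ℝ) - (N : ℝ) ^ 2 * volume.real (torusShell d a b)| ≤
      C * ((N : ℝ) ^ (2 - 2 * γ) * δ ^ (-(((d : ℝ) - 1) / 2 + 4 * ε)) + (N : ℝ) ^ 2 * δ) := by
  obtain ⟨C, hC, hsm⟩ := exists_norm_sum_smoothShell_sub_le hd hv hε hε1
  obtain ⟨D, hD, hvol⟩ := exists_volume_torusShell_le d hd
  refine ⟨C + 2 * D, by positivity, fun a b δ hδ N hN => ?_⟩
  set E := (N : ℝ) ^ (2 - 2 * γ) * δ ^ (-(((d : ℝ) - 1) / 2 + 4 * ε)) with hE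
  have hE0 : 0 ≤ E := by positivity
  have hre : ∀ s t : ℝ,
      |∑ n ∈ Finset.Icc 1 N, ∑ m ∈ Finset.Icc 1 N, (smoothShell d s t δ (v n - v m)).re -
        (N : ℝ) ^ 2 * volume.real (torusShell d s t)| ≤ C * E := by
    intro s t
    refine le_trans ?_ (hsm s t δ hδ N hN)
    refine le_of_eq_of_le ?_ (Complex.abs_re_le_norm _)
    simp only [Complex.sub_re, Complex.re_sum, Complex.ofReal_re]
  have hw1 : volume.real (torusShell d (a - δ) (b + δ)) ≤
      volume.real (torusShell d a b) + 2 * D * δ := by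
    have hsub : torusShell d (a - δ) (b + δ) ⊆
        torusShell d a b ∪ (torusShell d (a - δ) a ∪ torusShell d b (b + δ)) := by
      intro x hx
      simp only [torusShell, mem_union, mem_ofPred_eq] at hx ⊢
      grind
    have h1 := hvol (a - δ) a (by linarith)
    have h2 := hvol b (b + δ) (by linarith)
    have h3 := (measureReal_mono (μ := volume) hsub).trans (measureReal_union_le _ _)
    have h4 := measureReal_union_le (μ := volume) (torusShell d (a - δ) a) (torusShell d b (b + δ))
    linarith
  have hw2 : volume.real (torusShell d a b) ≤
      volume.real (torusShell d (a + δ) (b - δ)) + 2 * D * δ := by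
    have hsub : torusShell d a b ⊆
        torusShell d (a + δ) (b - δ) ∪ (torusShell d a (a + δ) ∪ torusShell d (b - δ) b) := by
      intro x hx
      simp only [torusShell, mem_union, mem_ofPred_eq] at hx ⊢
      grind
    have h1 := hvol a (a + δ) (by linarith)
    have h2 := hvol (b - δ) b (by linarith)
    have h3 := (measureReal_mono (μ := volume) hsub).trans (measureReal_union_le _ _)
    have h4 := measureReal_union_le (μ := volume) (torusShell d a (a + δ)) (torusShell d (b - δ) b)
    linarith
  have hup : (annulusCount v a b N : ℝ) ≤ ∑ n ∈ Finset.Icc 1 N, ∑ m ∈ Finset.Icc 1 N,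
      (smoothShell d (a - δ) (b + δ) δ (v n - v m)).re := by
    rw [annulusCount_eq_sum]
    refine Finset.sum_le_sum fun n _ => Finset.sum_le_sum fun m _ => ?_
    by_cases hx : v n - v m ∈ torusShell d a b
    · rw [indicator_of_mem hx, smoothShell_eq_one hδ.le (by simpa using hx)]
      simp
    · rw [indicator_of_notMem hx]
      exact re_smoothShell_nonneg _ _ _ _ _
  have hlo : ∑ n ∈ Finset.Icc 1 N, ∑ m ∈ Finset.Icc 1 N,
      (smoothShell d (a + δ) (b - δ) δ (v n - v m)).re ≤ (annulusCount v a b N : ℝ) := by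
    rw [annulusCount_eq_sum]
    refine Finset.sum_le_sum fun n _ => Finset.sum_le_sum fun m _ => ?_
    by_cases hx : v n - v m ∈ torusShell d a b
    · rw [indicator_of_mem hx]
      exact re_smoothShell_le_one _ _ _ _ _
    · rw [indicator_of_notMem hx, smoothShell_eq_zero hδ.le (by simpa using hx)]
      simp
  have h1 := abs_le.1 (hre (a - δ) (b + δ))
  have h2 := abs_le.1 (hre (a + δ) (b - δ))
  have hN2 : (0 : ℝ) ≤ (N : ℝ) ^ 2 := by positivity
  have h3 := mul_le_mul_of_nonneg_left hw1 hN2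
  have h4 := mul_le_mul_of_nonneg_left hw2 hN2
  have h5 : 0 ≤ C * ((N : ℝ) ^ 2 * δ) := by positivity
  have h6 : 0 ≤ D * E := by positivity
  rw [abs_le]
  constructor <;> linarith

/-- The asymptotic formula, from the choice `δ = N ^ (-4γ/(d+1))` that balances the two errors. -/
theorem exists_abs_annulusCount_sub_le_rpow {d : ℕ} (hd : d ≠ 0) {γ : ℝ} (hγ : 0 < γ)
    (hγ1 : γ ≤ 1 / 2) {v : ℕ → UnitAddTorus (Fin d)} (hv : IsGammaUniformlyDistributed γ v)
    {ε : ℝ} (hε : 0 < ε) :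
    ∃ C : ℝ, 0 < C ∧ ∀ a b : ℝ, ∀ N : ℕ, 1 ≤ N →
      |(annulusCount v a b N : ℝ) - (N : ℝ) ^ 2 * volume.real (annulusRel d a b)| ≤
        C * (N : ℝ) ^ (2 - 4 * γ / ((d : ℝ) + 1) + ε) := by
  -- The smoothing costs `κ * 4ε' ≤ ε / 2` in the exponent, where `κ = 4γ/(d+1) ≤ 1`.
  set ε' := min (ε / 8) (1 / 4)
  have hε' : 0 < ε' := lt_min (by linarith) (by norm_num)
  have hε8 : ε' ≤ ε / 8 := min_le_left _ _
  have hε4 : ε' < 1 / 2 := (min_le_right _ _).trans_lt (by norm_num)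
  obtain ⟨C, hC, h⟩ := exists_abs_annulusCount_sub_le hd hv hε' hε4
  refine ⟨2 * C, by positivity, fun a b N hN => ?_⟩
  have hN1 : (1 : ℝ) ≤ N := by exact_mod_cast hN
  have hN0 : (0 : ℝ) < N := by linarith
  have hd1 : (1 : ℝ) ≤ d := by exact_mod_cast Nat.one_le_iff_ne_zero.2 hd
  set κ := 4 * γ / ((d : ℝ) + 1) with hκ
  have hκ1 : κ ≤ 1 := by rw [hκ, div_le_one (by linarith)]; linarith
  have hκ2 : κ * ((d : ℝ) + 1) = 4 * γ := by rw [hκ]; field_simp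
  rw [volume_annulusRel]
  refine (h a b ((N : ℝ) ^ (-κ)) (by positivity) N hN).trans ?_
  have e1 : (N : ℝ) ^ (2 - 2 * γ) * ((N : ℝ) ^ (-κ)) ^ (-(((d : ℝ) - 1) / 2 + 4 * ε')) ≤
      (N : ℝ) ^ (2 - κ + ε) := by
    rw [← Real.rpow_mul hN0.le, ← Real.rpow_add hN0]
    refine Real.rpow_le_rpow_of_exponent_le hN1 ?_
    have : κ * ε' ≤ 1 * ε' := by gcongr
    linarith
  have e2 : (N : ℝ) ^ 2 * (N : ℝ) ^ (-κ) ≤ (N : ℝ) ^ (2 - κ + ε) := by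
    rw [← Real.rpow_natCast, ← Real.rpow_add hN0]
    refine Real.rpow_le_rpow_of_exponent_le hN1 ?_
    push_cast
    linarith
  calc _ ≤ C * ((N : ℝ) ^ (2 - κ + ε) + (N : ℝ) ^ (2 - κ + ε)) := by gcongr
    _ = _ := by ring

theorem mainTheorem1 (d : ℕ) (hd : 2 ≤ d) :
    ∃ c₁ c₂ : ℝ, 0 < c₁ ∧ 0 < c₂ ∧
      -- `|Ω_{a,b}| ≈ b - a`, with constants that depend only on `d`
      (∀ a b : ℝ, 1 / 100 ≤ a → a ≤ b → b < 1 / 2 →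
        c₁ * (b - a) ≤ MeasureTheory.volume.real (annulusRel d a b) ∧
          MeasureTheory.volume.real (annulusRel d a b) ≤ c₂ * (b - a)) ∧
      ∀ (γ : ℝ), 0 < γ → γ ≤ 1 / 2 →
      ∀ (v : ℕ → UnitAddTorus (Fin d)), IsGammaUniformlyDistributed γ v →
        -- the asymptotic formula, uniformly in `a` and `b`
        (∀ ε : ℝ, 0 < ε → ∃ C : ℝ, ∀ a b : ℝ, 1 / 100 ≤ a → a ≤ b → b < 1 / 2 →
          ∀ N : ℕ, 1 ≤ N →
            |(annulusCount v a b N : ℝ) -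
                (N : ℝ) ^ 2 * MeasureTheory.volume.real (annulusRel d a b)| ≤
              C * (N : ℝ) ^ (2 - 4 * γ / ((d : ℝ) + 1) + ε)) ∧
        -- the count is comparable to `N² (b - a)` once `b - a` is not too small
        (∀ c ε : ℝ, 0 < c → 0 < ε → ∃ N₀ : ℕ, ∀ N : ℕ, N₀ ≤ N →
          ∀ a b : ℝ, 1 / 100 ≤ a → a ≤ b → b < 1 / 2 →
            c * (N : ℝ) ^ (-(4 * γ / ((d : ℝ) + 1)) + ε) ≤ b - a →
              c₁ * ((N : ℝ) ^ 2 * (b - a)) ≤ (annulusCount v a b N : ℝ) ∧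
                (annulusCount v a b N : ℝ) ≤ c₂ * ((N : ℝ) ^ 2 * (b - a))) := by
  have hd0 : d ≠ 0 := by omega
  obtain ⟨D, hD, hup⟩ := exists_volume_torusShell_le d hd0
  obtain ⟨c, hc, hlo⟩ := exists_le_volume_torusShell d hd0
  refine ⟨c / 2, D + c / 2, by positivity, by positivity, fun a b ha hab hb => ?_,
    fun γ hγ hγ1 v hv => ⟨fun ε hε => ?_, fun c' ε hc' hε => ?_⟩⟩
  · rw [volume_annulusRel]
    have h1 := hup a b hab
    have h2 := hlo a b ha hab hb
    have h3 : 0 ≤ c * (b - a) := mul_nonneg hc.le (by linarith)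
    constructor <;> linarith
  · obtain ⟨C, -, h⟩ := exists_abs_annulusCount_sub_le_rpow hd0 hγ hγ1 hv hε
    exact ⟨C, fun a b _ _ _ N hN => h a b N hN⟩
  · -- The asymptotic formula with `ε / 2` in place of `ε` leaves a factor `N ^ (-ε / 2)` to spare.
    obtain ⟨C, hC, h⟩ := exists_abs_annulusCount_sub_le_rpow hd0 hγ hγ1 hv (half_pos hε)
    have hlim : Tendsto (fun N : ℕ => (N : ℝ) ^ (-(ε / 2))) atTop (𝓝 0) :=
      (tendsto_rpow_neg_atTop (half_pos hε)).comp tendsto_natCast_atTop_atTop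
    obtain ⟨N₁, hN₁⟩ := eventually_atTop.1 (hlim.eventually (gt_mem_nhds
      (show 0 < c / 2 * c' / C by positivity)))
    refine ⟨max N₁ 1, fun N hN a b ha hab hb hw => ?_⟩
    have hN1 : 1 ≤ N := (le_max_right _ _).trans hN
    have hN0 : (0 : ℝ) < N := by exact_mod_cast hN1
    have hsmall := hN₁ N ((le_max_left _ _).trans hN)
    rw [lt_div_iff₀ hC] at hsmall
    have hcount := h a b N hN1
    set κ := 4 * γ / ((d : ℝ) + 1)
    have herr : C * (N : ℝ) ^ (2 - κ + ε / 2) ≤ c / 2 * ((N : ℝ) ^ 2 * (b - a)) := by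
      calc C * (N : ℝ) ^ (2 - κ + ε / 2)
          = (N : ℝ) ^ (-(ε / 2)) * C * ((N : ℝ) ^ 2 * (N : ℝ) ^ (-κ + ε)) := by
            have : (N : ℝ) ^ (2 - κ + ε / 2) =
                (N : ℝ) ^ (-(ε / 2)) * ((N : ℝ) ^ 2 * (N : ℝ) ^ (-κ + ε)) := by
              rw [← Real.rpow_natCast, ← Real.rpow_add hN0, ← Real.rpow_add hN0]
              congr 1; push_cast; ring
            rw [this]; ring
        _ ≤ c / 2 * c' * ((N : ℝ) ^ 2 * (N : ℝ) ^ (-κ + ε)) := by gcongr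
        _ = c / 2 * ((N : ℝ) ^ 2 * (c' * (N : ℝ) ^ (-κ + ε))) := by ring
        _ ≤ _ := by gcongr
    rw [volume_annulusRel] at hcount
    have h1 := mul_le_mul_of_nonneg_left (hup a b hab) (by positivity : (0 : ℝ) ≤ (N : ℝ) ^ 2)
    have h2 := mul_le_mul_of_nonneg_left (hlo a b ha hab hb)
      (by positivity : (0 : ℝ) ≤ (N : ℝ) ^ 2)
    have h3 := abs_le.1 (hcount.trans herr)
    constructor <;> linarith
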